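/- Let $X$ be a real Banach lattice with norm dual $X^*$. A net $(f_\alpha)$ in $X$ *order converges* to $f$ if there is a net $h_\gamma\downarrow 0$ in $X$ such that for every $\gamma$ there is $\alpha_0$ with $|f_\alpha-f|\le h_\gamma$ for all $\alpha\ge\alpha_0$. The space $X$ is *order continuous* if $\|f_\alpha\|\to 0$ whenever $(f_\alpha)$ order converges to $0$ and $|f_\alpha|\le |f|$ for all $\alpha$, for some $f\in X$. It is *sequentially monotonically bounded* if every increasing norm bounded sequence in $X_+$ has an upper bound in $X$. The *Cesàro sequence* of $(f_n)_{n\ge1}$ is $\left(\frac1m\sum_{n=1}^m f_n\right)_{m\ge 1}$, and $(f_n)$ is *disjoint* if $|f_i|\wedge|f_j|=0$ for $i\ne j$. $X$ has $doBSP$ if every norm bounded disjoint sequence in $X$ has a subsequence whose Cesàro sequence order converges in $X$. $X$ has $hdoBSP$ if every norm bounded disjoint sequence in $X$ has a subsequence such that the Cesàro sequences of all its further subsequences order converge to the same limit in $X$. For a topology $\tau$ on $X$, the properties $\tau$-$doBSP$ and $\tau$-$hdoBSP$ are defined in the same way, but only for $\tau$-null norm bounded disjoint sequences. For an ideal (solid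 linear subspace) $I$ of $X^*$, let $\sigma_I=\sigma(X,I)$ be the coarsest topology on $X$ making every $g\in I$ continuous, and let $|\sigma_I|=|\sigma|(X,I)$ be the locally convex topology generated by the seminorms $f\mapsto |g|(|f|)$, $g\in I$. **Theorem.** Suppose that $X$ is order continuous or sequentially monotonically bounded. Then $X$ has $doBSP$ if and only if it has $hdoBSP$. Moreover, for every ideal $I$ of $X^*$ and for $\tau=\sigma_I$ or $\tau=|\sigma_I|$, $X$ has $\tau$-$doBSP$ if and only if it has $\tau$-$hdoBSP$. -/

import Mathlib

open Filter Topology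

noncomputable section

/-! A (real) Banach lattice is a type `X` with the instances
`[NormedAddCommGroup X] [NormedSpace ℝ X] [CompleteSpace X] [Lattice X] [IsOrderedAddMonoid X]
[IsOrderedModule ℝ X] [HasSolidNorm X]`.
Its norm dual `X*` is `StrongDual ℝ X`. -/

namespace BanachLattice

universe u v

/-! ### The modulus of a functional in the dual Banach lattice -/

section Modulus

variable {X : Type u} [NormedAddCommGroup X] [NormedSpace ℝ X] [Lattice X]

/-- The value of `|g|` at `x ≥ 0`, by the Riesz–Kantorovich formula
`|g|(x) = sup {g y : |y| ≤ x}`. -/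
def modulusOn (g : StrongDual ℝ X) (x : X) : ℝ :=
  sSup (g '' {y | |y| ≤ x})

variable [IsOrderedAddMonoid X] [HasSolidNorm X]

theorem bddAbove_modulusOn (g : StrongDual ℝ X) (x : X) :
    BddAbove (g '' {y | |y| ≤ x}) := by
  refine ⟨‖g‖ * ‖x‖, ?_⟩
  rintro _ ⟨y, hy, rfl⟩
  have h1 : ‖y‖ ≤ ‖x‖ := HasSolidNorm.solid (hy.trans (le_abs_self x))
  calc g y ≤ ‖g y‖ := Real.le_norm_self _
    _ ≤ ‖g‖ * ‖y‖ := g.le_opNorm y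
    _ ≤ ‖g‖ * ‖x‖ := by gcongr

theorem le_modulusOn (g : StrongDual ℝ X) {x y : X} (h : |y| ≤ x) : g y ≤ modulusOn g x :=
  le_csSup (bddAbove_modulusOn g x) ⟨y, h, rfl⟩

theorem modulusOn_le (g : StrongDual ℝ X) {x : X} (hx : 0 ≤ x) {c : ℝ}
    (h : ∀ y, |y| ≤ x → g y ≤ c) : modulusOn g x ≤ c := by
  refine csSup_le ⟨g 0, 0, by simpa using hx, rfl⟩ ?_
  rintro _ ⟨y, hy, rfl⟩
  exact h y hy

theorem modulusOn_nonneg (g : StrongDual ℝ X) {x : X} (hx : 0 ≤ x) : 0 ≤ modulusOn g x := by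
  simpa using le_modulusOn g (show |(0 : X)| ≤ x by simpa using hx)

theorem modulusOn_le_norm (g : StrongDual ℝ X) {x : X} (hx : 0 ≤ x) :
    modulusOn g x ≤ ‖g‖ * ‖x‖ := by
  refine modulusOn_le g hx fun y hy => ?_
  have h1 : ‖y‖ ≤ ‖x‖ := HasSolidNorm.solid (hy.trans (le_abs_self x))
  calc g y ≤ ‖g y‖ := Real.le_norm_self _
    _ ≤ ‖g‖ * ‖y‖ := g.le_opNorm y
    _ ≤ ‖g‖ * ‖x‖ := by gcongr

theorem modulusOn_mono (g : StrongDual ℝ X) {x y : X} (hx : 0 ≤ x) (h : x ≤ y) :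
    modulusOn g x ≤ modulusOn g y :=
  modulusOn_le g hx fun _ hz => le_modulusOn g (hz.trans h)

/-- Riesz decomposition. -/
theorem exists_add_of_abs_le {x y z : X} (hx : 0 ≤ x) (hy : 0 ≤ y) (h : |z| ≤ x + y) :
    ∃ a b : X, |a| ≤ x ∧ |b| ≤ y ∧ a + b = z := by
  obtain ⟨h1, h2⟩ := abs_le'.1 h
  refine ⟨(z ⊓ x) ⊔ (-x), z - ((z ⊓ x) ⊔ (-x)), ?_, ?_, by abel⟩
  · refine abs_le'.2 ⟨sup_le inf_le_right ((neg_nonpos.2 hx).trans hx), ?_⟩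
    exact neg_le.1 le_sup_right
  · refine abs_le'.2 ⟨?_, ?_⟩
    · refine sub_le_comm.1 (le_trans (le_inf ?_ ?_) le_sup_left)
      · exact sub_le_self _ hy
      · exact sub_le_iff_le_add.2 h1
    · rw [neg_sub]
      refine sub_le_iff_le_add.2 (sup_le ?_ ?_)
      · exact inf_le_left.trans (le_add_of_nonneg_left hy)
      · have h3 : -z - y ≤ x := sub_le_iff_le_add.2 h2
        have h4 := neg_le_neg h3
        rwa [neg_sub, sub_neg_eq_add] at h4

theorem modulusOn_add (g : StrongDual ℝ X) {x y : X} (hx : 0 ≤ x) (hy : 0 ≤ y) :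
    modulusOn g (x + y) = modulusOn g x + modulusOn g y := by
  apply le_antisymm
  · refine modulusOn_le g (add_nonneg hx hy) fun z hz => ?_
    obtain ⟨a, b, ha, hb, rfl⟩ := exists_add_of_abs_le hx hy hz
    rw [map_add]
    exact add_le_add (le_modulusOn g ha) (le_modulusOn g hb)
  · have h1 : ∀ a, |a| ≤ x → modulusOn g y ≤ modulusOn g (x + y) - g a := fun a ha =>
      modulusOn_le g hy fun b hb => by
        have := le_modulusOn g ((abs_add_le a b).trans (add_le_add ha hb))
        rw [map_add] at this
        linarith
    have h2 : modulusOn g x ≤ modulusOn g (x + y) - modulusOn g y :=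
      modulusOn_le g hx fun a ha => by linarith [h1 a ha]
    linarith

/-- The modulus `|g| ∈ X*` of a functional `g ∈ X*`: the unique linear functional given by the
Riesz–Kantorovich formula on the positive cone. -/
def modulus (g : StrongDual ℝ X) : StrongDual ℝ X :=
  AddMonoidHom.toRealLinearMap
    (AddMonoidHom.mk' (fun x => modulusOn g x⁺ - modulusOn g x⁻) (fun x y => by
      have h : (x + y)⁺ + (x⁻ + y⁻) = (x + y)⁻ + (x⁺ + y⁺) := by
        have h1 := posPart_sub_negPart (x + y)
        have h2 := posPart_sub_negPart x
        have h3 := posPart_sub_negPart y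
        rw [← sub_eq_zero]
        calc _ = ((x + y)⁺ - (x + y)⁻) - (x⁺ - x⁻) - (y⁺ - y⁻) := by abel
          _ = 0 := by rw [h1, h2, h3]; abel
      have h' := congrArg (modulusOn g) h
      rw [modulusOn_add g (posPart_nonneg _) (add_nonneg (negPart_nonneg _) (negPart_nonneg _)),
        modulusOn_add g (negPart_nonneg _) (add_nonneg (posPart_nonneg _) (posPart_nonneg _)),
        modulusOn_add g (negPart_nonneg _) (negPart_nonneg _),
        modulusOn_add g (posPart_nonneg _) (posPart_nonneg _)] at h'
      linarith))
    (AddMonoidHomClass.continuous_of_bound _ ‖g‖ (fun x => by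
      have hp := modulusOn_nonneg g (posPart_nonneg x)
      have hn := modulusOn_nonneg g (negPart_nonneg x)
      have h1 : modulusOn g x⁺ + modulusOn g x⁻ ≤ ‖g‖ * ‖x‖ := by
        rw [← modulusOn_add g (posPart_nonneg _) (negPart_nonneg _), posPart_add_negPart,
          ← norm_abs_eq_norm x]
        exact modulusOn_le_norm g (abs_nonneg x)
      change |modulusOn g x⁺ - modulusOn g x⁻| ≤ _
      rw [abs_le]
      constructor <;> linarith))

theorem modulus_apply_of_nonneg (g : StrongDual ℝ X) {x : X} (hx : 0 ≤ x) :
    modulus g x = modulusOn g x := by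
  have h0 : modulusOn g (0 : X) = 0 := by
    have := modulusOn_add g (le_refl (0 : X)) le_rfl
    rw [add_zero] at this
    linarith
  change modulusOn g x⁺ - modulusOn g x⁻ = _
  rw [posPart_of_nonneg hx, negPart_of_nonneg hx, h0, sub_zero]

/-- An (order) ideal of `X*`: a linear subspace `I` that is solid, i.e. `|g| ≤ |f|` and `f ∈ I`
imply `g ∈ I`, where `φ ≤ ψ` in `X*` means `φ x ≤ ψ x` for all `x ≥ 0`. -/
def IsDualIdeal (I : Submodule ℝ (StrongDual ℝ X)) : Prop :=
  ∀ f ∈ I, ∀ g : StrongDual ℝ X, (∀ x : X, 0 ≤ x → modulus g x ≤ modulus f x) → g ∈ I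

end Modulus

/-! ### The topologies `σ(X, I)` and `|σ|(X, I)` -/

section Topologies

variable {X : Type u} [NormedAddCommGroup X] [NormedSpace ℝ X]

/-- `σ(X, I)`: the coarsest topology on `X` making every `g ∈ I` continuous. -/
def sigmaTopology (I : Submodule ℝ (StrongDual ℝ X)) : TopologicalSpace X :=
  ⨅ g : I, TopologicalSpace.induced (fun x : X => (g : StrongDual ℝ X) x) inferInstance

variable [Lattice X] [IsOrderedAddMonoid X] [IsOrderedModule ℝ X]

theorem abs_real_smul (c : ℝ) (x : X) : |c • x| = |c| • |x| := by
  have key : ∀ (a : ℝ) (y : X), 0 < a → |a • y| = a • |y| := fun a y ha => by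
    have h := (OrderIso.smulRight (β := X) ha).map_sup y (-y)
    simp only [OrderIso.smulRight_apply, smul_neg] at h
    exact h.symm
  rcases lt_trichotomy c 0 with hc | hc | hc
  · rw [abs_of_neg hc, ← key (-c) x (neg_pos.2 hc), neg_smul, abs_neg]
  · simp [hc]
  · rw [abs_of_pos hc, key c x hc]

variable [HasSolidNorm X]

/-- The lattice seminorm `x ↦ |g|(|x|)` attached to `g ∈ X*`. -/
def absSeminorm (g : StrongDual ℝ X) : Seminorm ℝ X :=
  Seminorm.of (fun x => modulus g |x|)
    (fun x y => by
      rw [modulus_apply_of_nonneg g (abs_nonneg _), ← map_add,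
        modulus_apply_of_nonneg g (add_nonneg (abs_nonneg x) (abs_nonneg y))]
      exact modulusOn_mono g (abs_nonneg _) (abs_add_le x y))
    (fun c x => by
      rw [abs_real_smul, map_smul, smul_eq_mul, Real.norm_eq_abs])

/-- `|σ|(X, I)`: the locally convex topology on `X` generated by the seminorms `x ↦ |g|(|x|)`,
`g ∈ I`. -/
def absSigmaTopology (I : Submodule ℝ (StrongDual ℝ X)) : TopologicalSpace X :=
  SeminormFamily.moduleFilterBasis (fun g : I => absSeminorm (g : StrongDual ℝ X)) |>.topology

end Topologies

/-! ### Order convergence and order conditions on `X` -/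

section Order

variable {X : Type u} [NormedAddCommGroup X] [Lattice X]

/-- The net `f`, indexed by `A`, order converges to `x`: there is a net `h γ ↓ 0`
(over a nonempty directed set `Γ`) such that for every `γ` one has `|f α - x| ≤ h γ` for all
sufficiently large `α`. -/
def OrderTendsto {A : Type v} [Preorder A] (f : A → X) (x : X) : Prop :=
  ∃ (Γ : Type u) (_ : Preorder Γ) (_ : Nonempty Γ) (_ : IsDirectedOrder Γ) (h : Γ → X),
    Antitone h ∧ IsGLB (Set.range h) 0 ∧ ∀ γ, ∃ α₀, ∀ α, α₀ ≤ α → |f α - x| ≤ h γ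

variable (X) in
/-- The order continuous part `X_a`: all `x` such that `‖f α‖ → 0` for every net `f` that order
converges to `0` and satisfies `|f α| ≤ |x|`. -/
def orderContinuousPart : Set X :=
  {x | ∀ (A : Type u) [Preorder A] [Nonempty A] [IsDirectedOrder A] (f : A → X),
    OrderTendsto f 0 → (∀ α, |f α| ≤ |x|) → Tendsto (fun α => ‖f α‖) atTop (𝓝 0)}

variable (X) in
/-- `X` is order continuous: `X_a = X`. -/
def IsOrderContinuous : Prop := orderContinuousPart X = Set.univ

variable (X) in
/-- Every increasing norm bounded sequence in `X₊` has an upper bound. -/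
def IsSeqMonotonicallyBounded : Prop :=
  ∀ f : ℕ → X, Monotone f → (∀ n, 0 ≤ f n) → (∃ C : ℝ, ∀ n, ‖f n‖ ≤ C) →
    BddAbove (Set.range f)

end Order

/-! ### Disjoint order Banach–Saks properties -/

section BanachSaks

variable {X : Type u} [NormedAddCommGroup X] [NormedSpace ℝ X] [Lattice X]

/-- The Cesàro sequence of `f`; its term of index `m` is the mean of the first `m + 1` terms. -/
def cesaro (f : ℕ → X) (m : ℕ) : X :=
  ((m + 1 : ℕ) : ℝ)⁻¹ • ∑ n ∈ Finset.range (m + 1), f n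

/-- `f` is norm bounded and disjoint. -/
def IsBoundedDisjoint (f : ℕ → X) : Prop :=
  (∃ C : ℝ, ∀ n, ‖f n‖ ≤ C) ∧ ∀ i j, i ≠ j → |f i| ⊓ |f j| = 0

/-- Some subsequence of `f` has an order convergent Cesàro sequence. -/
def HasOrderCesaroSubseq (f : ℕ → X) : Prop :=
  ∃ φ : ℕ → ℕ, StrictMono φ ∧ ∃ x : X, OrderTendsto (cesaro (f ∘ φ)) x

/-- Some subsequence of `f` is such that the Cesàro sequences of all its further subsequences
order converge to the same limit. -/
def HasHereditaryOrderCesaroSubseq (f : ℕ → X) : Prop :=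
  ∃ φ : ℕ → ℕ, StrictMono φ ∧ ∃ x : X, ∀ ψ : ℕ → ℕ, StrictMono ψ →
    OrderTendsto (cesaro (f ∘ φ ∘ ψ)) x

variable (X) in
/-- The disjoint order Banach–Saks property `doBSP`. -/
def DoBSP : Prop := ∀ f : ℕ → X, IsBoundedDisjoint f → HasOrderCesaroSubseq f

variable (X) in
/-- The hereditary disjoint order Banach–Saks property `hdoBSP`. -/
def HdoBSP : Prop := ∀ f : ℕ → X, IsBoundedDisjoint f → HasHereditaryOrderCesaroSubseq f

/-- The `τ`-disjoint order Banach–Saks property `τ`-`doBSP`. -/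
def TauDoBSP (τ : TopologicalSpace X) : Prop :=
  ∀ f : ℕ → X, Tendsto f atTop (@nhds X τ 0) → IsBoundedDisjoint f → HasOrderCesaroSubseq f

/-- The hereditary `τ`-disjoint order Banach–Saks property `τ`-`hdoBSP`. -/
def TauHdoBSP (τ : TopologicalSpace X) : Prop :=
  ∀ f : ℕ → X, Tendsto f atTop (@nhds X τ 0) → IsBoundedDisjoint f →
    HasHereditaryOrderCesaroSubseq f

end BanachSaks

end BanachLattice

end

/-!
The topology plays no role beyond the fact that subsequences of `τ`-null sequences are `τ`-null, so
everything comes down to a single disjoint sequence `f` all of whose subsequences have a further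
subsequence with order convergent Cesàro sequence.

*Order boundedness of a series.* For a disjoint sequence `f` in an Archimedean space, the Cesàro
sequence of `f` order converges if and only if the partial sums of `∑ |f n| / (n + 1)` have an upper
bound, and then the limit can be taken to be `0` (`OrderTendsto.bddAbove_harmonicSum`,
`orderTendsto_cesaro_zero`). If the Cesàro sequence is order bounded, so are the terms
`|f n| / (n + 1)`, hence their sums by disjointness. Conversely, the differences `v - T m`, where `v`
runs through the upper bounds of an increasing sequence `T`, decrease to `0` by the Archimedean
property, and for suitable `T` they dominate the Cesàro means. This net also shows that increasing
order bounded sequences are norm Cauchy in an order continuous space, so in both cases of the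
theorem order boundedness of the partial sums is a condition on their norms: being Cauchy, or being
bounded.

*Ramsey argument.* These norm conditions are countable combinations of closed conditions on the
subsequence, and a subsequence for which they hold hereditarily is found with the
Galvin–Nash-Williams theorem for open sets (`exists_homogeneous_of_open`) and diagonalization
(`exists_fusion`). The passage from closed conditions to the actual ones uses the shifted sums
`∑ |f (φ k)| / (k + p + 1)`: deleting the first `p` terms of a sequence compares its remainders with
shifted sums, so that a uniform estimate of the shifted sums for some `p` is available on an infinite
set (`exists_norm_harmonicSum_le`), and such an estimate in turn controls the original sums.
-/

noncomputable section

namespace BanachLattice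

/-! ### Ramsey theory of infinite subsets of `ℕ` -/

/-- Fusion: if every `D n` is hereditary and every infinite set has an infinite subset satisfying
`D n`, then a diagonal set satisfies all the `D n` at once, up to discarding initial segments. -/
theorem exists_fusion {D : ℕ → Set ℕ → Prop} {M : Set ℕ} (hM : M.Infinite)
    (mono : ∀ n A B, A ⊆ B → D n B → D n A)
    (dense : ∀ n, ∀ A ⊆ M, A.Infinite → ∃ B ⊆ A, B.Infinite ∧ D n B) :
    ∃ N ⊆ M, N.Infinite ∧ D 0 N ∧ ∀ n ∈ N, D (n + 1) (N ∩ Set.Ioi n) := by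
  obtain ⟨M₀, hM₀, hi₀, hD₀⟩ := dense 0 M subset_rfl hM
  have step : ∀ A : {A : Set ℕ // A ⊆ M ∧ A.Infinite}, ∃ B : {A : Set ℕ // A ⊆ M ∧ A.Infinite},
      B.1 ⊆ A.1 ∩ Set.Ioi (sInf A.1) ∧ D (sInf A.1 + 1) B.1 := by
    rintro ⟨A, hA, hAi⟩
    have hi : (A ∩ Set.Ioi (sInf A)).Infinite := by
      have := hAi.sdiff (Set.finite_Iic (sInf A))
      refine this.mono fun x hx => ⟨hx.1, ?_⟩
      simpa using hx.2
    obtain ⟨B, hB, hBi, hD⟩ := dense (sInf A + 1) _ (Set.inter_subset_left.trans hA) hi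
    exact ⟨⟨B, hB.trans (Set.inter_subset_left.trans hA), hBi⟩, hB, hD⟩
  choose next hnext hDnext using step
  let s : ℕ → {A : Set ℕ // A ⊆ M ∧ A.Infinite} :=
    fun k => next^[k] ⟨M₀, hM₀, hi₀⟩
  have hs : ∀ k, s (k + 1) = next (s k) := fun k => Function.iterate_succ_apply' _ _ _
  let a : ℕ → ℕ := fun k => sInf (s k).1
  have ha : ∀ k, a k ∈ (s k).1 := fun k => Nat.sInf_mem (s k).2.2.nonempty
  have hsub : ∀ k, (s (k + 1)).1 ⊆ (s k).1 ∩ Set.Ioi (a k) := fun k => by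
    rw [hs]; exact hnext _
  have hanti : Antitone fun k => (s k).1 :=
    antitone_nat_of_succ_le fun k => (hsub k).trans Set.inter_subset_left
  have hmono : StrictMono a := strictMono_nat_of_lt_succ fun k => (hsub k (ha (k + 1))).2
  have hN : ∀ k, a k ∈ (s 0).1 := fun k => hanti (Nat.zero_le k) (ha k)
  refine ⟨Set.range a, ?_, Set.infinite_range_of_injective hmono.injective, ?_, ?_⟩
  · rintro _ ⟨k, rfl⟩
    exact hM₀ (hN k)
  · refine mono _ _ _ ?_ hD₀
    rintro _ ⟨k, rfl⟩
    exact hN k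
  · rintro _ ⟨k, rfl⟩
    refine mono _ _ (s (k + 1)).1 ?_ (by rw [hs]; exact hDnext _)
    rintro _ ⟨⟨j, rfl⟩, hj⟩
    exact hanti (Nat.succ_le_of_lt (hmono.lt_iff_lt.1 hj)) (ha j)

/-- Finitely many hereditary dense properties can be achieved simultaneously. -/
theorem exists_infinite_subset_forall_mem_finset {ι : Type*} {D : ι → Set ℕ → Prop}
    (mono : ∀ i A B, A ⊆ B → D i B → D i A) (F : Finset ι) {M : Set ℕ} (hM : M.Infinite)
    (dense : ∀ i ∈ F, ∀ A ⊆ M, A.Infinite → ∃ B ⊆ A, B.Infinite ∧ D i B) :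
    ∃ B ⊆ M, B.Infinite ∧ ∀ i ∈ F, D i B := by
  classical
  induction F using Finset.induction_on with
  | empty => exact ⟨M, subset_rfl, hM, by simp⟩
  | insert i F _ ih =>
    obtain ⟨B, hB, hBi, hD⟩ := ih fun j hj => dense j (Finset.mem_insert_of_mem hj)
    obtain ⟨C, hC, hCi, hDC⟩ := dense i (Finset.mem_insert_self _ _) B hB hBi
    refine ⟨C, hC.trans hB, hCi, fun j hj => ?_⟩
    rcases Finset.mem_insert.1 hj with rfl | hj
    · exact hDC
    · exact mono _ _ _ hC (hD j hj)

/-- `M` accepts the finite set `s` (relative to the family `U`): every extension of `s` by an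
infinite subset of `M` lying above `s` belongs to `U`. -/
def Accepts (U : Set ℕ → Prop) (M : Set ℕ) (s : Finset ℕ) : Prop :=
  ∀ X ⊆ M, X.Infinite → (∀ a ∈ s, ∀ x ∈ X, a < x) → U (s ∪ X)

/-- `M` rejects `s`: no infinite subset of `M` accepts `s`. -/
def Rejects (U : Set ℕ → Prop) (M : Set ℕ) (s : Finset ℕ) : Prop :=
  ∀ N ⊆ M, N.Infinite → ¬ Accepts U N s

theorem Accepts.mono {U : Set ℕ → Prop} {M N : Set ℕ} {s : Finset ℕ} (h : Accepts U M s)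
    (hN : N ⊆ M) : Accepts U N s :=
  fun X hX => h X (hX.trans hN)

theorem Rejects.mono {U : Set ℕ → Prop} {M N : Set ℕ} {s : Finset ℕ} (h : Rejects U M s)
    (hN : N ⊆ M) : Rejects U N s :=
  fun X hX => h X (hX.trans hN)

theorem _root_.Set.Infinite.inter_Ici {M : Set ℕ} (hM : M.Infinite) (k : ℕ) :
    (M ∩ Set.Ici k).Infinite :=
  (hM.sdiff (Set.finite_Iio k)).mono fun x hx => ⟨hx.1, by simpa using hx.2⟩

/-- Acceptance of `s` only depends on the part of the set above `s`. -/
theorem Accepts.of_inter_Ici {U : Set ℕ → Prop} {M : Set ℕ} {n : ℕ} {s : Finset ℕ}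
    (hs : ∀ X ⊆ M, (∀ a ∈ s, ∀ x ∈ X, a < x) → X ⊆ Set.Ici n)
    (h : Accepts U (M ∩ Set.Ici n) s) : Accepts U M s :=
  fun X hX hi hsX => h X (Set.subset_inter hX (hs X hX hsX)) hi hsX

theorem Rejects.of_inter_Ici {U : Set ℕ → Prop} {M : Set ℕ} {n : ℕ} {s : Finset ℕ}
    (h : Rejects U (M ∩ Set.Ici n) s) : Rejects U M s :=
  fun N hN hi hacc => h (N ∩ Set.Ici n) (Set.inter_subset_inter_left _ hN)
    (hi.inter_Ici n) (hacc.mono Set.inter_subset_left)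

/-- Every infinite set has an infinite subset that decides all of its finite subsets. -/
theorem exists_forall_accepts_or_rejects (U : Set ℕ → Prop) {M : Set ℕ} (hM : M.Infinite) :
    ∃ N ⊆ M, N.Infinite ∧ ∀ s : Finset ℕ, (s : Set ℕ) ⊆ N → Accepts U N s ∨ Rejects U N s := by
  have mono : ∀ (s : Finset ℕ) (A B : Set ℕ), A ⊆ B →
      Accepts U B s ∨ Rejects U B s → Accepts U A s ∨ Rejects U A s :=
    fun s A B h => Or.imp (fun h' => h'.mono h) fun h' => h'.mono h
  have dense : ∀ (s : Finset ℕ) (A : Set ℕ), A.Infinite →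
      ∃ B ⊆ A, B.Infinite ∧ (Accepts U B s ∨ Rejects U B s) := fun s A hA => by
    by_cases h : Rejects U A s
    · exact ⟨A, subset_rfl, hA, Or.inr h⟩
    · simp only [Rejects, not_forall, not_not] at h
      obtain ⟨B, hB, hBi, hacc⟩ := h
      exact ⟨B, hB, hBi, Or.inl hacc⟩
  obtain ⟨N, hN, hNi, h0, h1⟩ := exists_fusion
    (D := fun n A => ∀ s ∈ (Finset.range n).powerset, Accepts U A s ∨ Rejects U A s) hM
    (fun n A B h hB s hs => mono s A B h (hB s hs))
    (fun n A _ hA => exists_infinite_subset_forall_mem_finset mono _ hA fun s _ B _ => dense s B)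
  refine ⟨N, hN, hNi, fun s hs => ?_⟩
  rcases s.eq_empty_or_nonempty with rfl | hne
  · exact h0 ∅ (by simp)
  · have hmax := s.max'_mem hne
    have hIoi : N ∩ Set.Ioi (s.max' hne) = N ∩ Set.Ici (s.max' hne + 1) := by
      ext x; simp
    have := h1 _ (hs hmax) s (Finset.mem_powerset.2 fun x hx =>
      Finset.mem_range.2 (Nat.lt_succ_of_le (s.le_max' x hx)))
    rw [hIoi] at this
    exact this.imp
      (Accepts.of_inter_Ici fun X _ hX x hx => Nat.succ_le_of_lt (hX _ hmax x hx))
      Rejects.of_inter_Ici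

/-- If `M` rejects `s`, then it rejects all but finitely many of its one-point end extensions,
provided that `M` decides them. -/
theorem Rejects.finite_setOf_not_rejects {U : Set ℕ → Prop} {M : Set ℕ} {s : Finset ℕ}
    (hs : (s : Set ℕ) ⊆ M) (h : Rejects U M s)
    (hM : ∀ s : Finset ℕ, (s : Set ℕ) ⊆ M → Accepts U M s ∨ Rejects U M s) :
    {x ∈ M | ¬ Rejects U M (insert x s)}.Finite := by
  by_contra hinf
  refine h _ (Set.sep_subset _ _) hinf fun X hX hXi hsX => ?_
  have hm := Nat.sInf_mem hXi.nonempty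
  have hmM := hX hm
  have hacc : Accepts U M (insert (sInf X) s) := by
    refine (hM _ ?_).resolve_right hmM.2
    rw [Finset.coe_insert]
    exact Set.insert_subset hmM.1 hs
  have hlt : ∀ x ∈ X \ {sInf X}, sInf X < x := fun x hx =>
    lt_of_le_of_ne (Nat.sInf_le hx.1) (Ne.symm hx.2)
  have := hacc (X \ {sInf X}) (fun x hx => (hX hx.1).1) (hXi.sdiff (Set.finite_singleton _))
    (fun a ha x hx => by
      rcases Finset.mem_insert.1 ha with rfl | ha
      · exact hlt x hx
      · exact hsX a ha x hx.1)
  convert this using 1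
  ext x
  by_cases hx : x = sInf X
  · simp [hx, hm]
  · simp [hx]

/-- The Galvin–Nash-Williams theorem: open families of infinite subsets of `ℕ` are Ramsey. -/
theorem exists_homogeneous_of_open {U : Set ℕ → Prop}
    (hU : ∀ A, A.Infinite → U A → ∃ k, ∀ B : Set ℕ, B ∩ Set.Iio k = A ∩ Set.Iio k → B.Infinite →
      U B) {M : Set ℕ} (hM : M.Infinite) :
    ∃ N ⊆ M, N.Infinite ∧
      ((∀ A ⊆ N, A.Infinite → U A) ∨ ∀ A ⊆ N, A.Infinite → ¬ U A) := by
  obtain ⟨M₁, hM₁, hi₁, hdec⟩ := exists_forall_accepts_or_rejects U hM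
  rcases hdec ∅ (by simp) with h0 | h0
  · refine ⟨M₁, hM₁, hi₁, Or.inl fun A hA hAi => ?_⟩
    simpa using h0 A hA hAi (by simp)
  obtain ⟨N, hN, hNi, hN0, hN1⟩ := exists_fusion
    (D := fun n A => ∀ s ∈ (Finset.range n).powerset, (s : Set ℕ) ⊆ M₁ → Rejects U M₁ s →
      ∀ x ∈ A, Rejects U M₁ (insert x s)) hi₁
    (fun n A B h hB s hs hs' hr x hx => hB s hs hs' hr x (h hx))
    (fun n A hA hAi => exists_infinite_subset_forall_mem_finset
      (D := fun (s : Finset ℕ) A => (s : Set ℕ) ⊆ M₁ → Rejects U M₁ s →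
        ∀ x ∈ A, Rejects U M₁ (insert x s))
      (fun s A B h hB hs' hr x hx => hB hs' hr x (h hx)) _ hAi fun s _ B hB hBi => by
        by_cases hs : (s : Set ℕ) ⊆ M₁ ∧ Rejects U M₁ s
        · refine ⟨_, Set.sdiff_subset, hBi.sdiff (hs.2.finite_setOf_not_rejects hs.1 hdec),
            fun _ _ x hx => ?_⟩
          by_contra hcon
          exact hx.2 ⟨hA (hB hx.1), hcon⟩
        · exact ⟨B, subset_rfl, hBi, fun h1 h2 => absurd ⟨h1, h2⟩ hs⟩)
  have hrej : ∀ s : Finset ℕ, (s : Set ℕ) ⊆ N → Rejects U M₁ s := by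
    intro s
    induction s using Finset.induction_on_max with
    | empty => exact fun _ => h0
    | insert a s hlt ih =>
      intro hs
      rw [Finset.coe_insert, Set.insert_subset_iff] at hs
      have hr := ih hs.2
      rcases s.eq_empty_or_nonempty with rfl | hne
      · exact hN0 ∅ (by simp) (by simp) hr a hs.1
      · have hmax := s.max'_mem hne
        exact hN1 _ (hs.2 hmax) s (Finset.mem_powerset.2 fun x hx =>
          Finset.mem_range.2 (Nat.lt_succ_of_le (s.le_max' x hx))) (hs.2.trans hN) hr a
          ⟨hs.1, hlt _ hmax⟩
  refine ⟨N, hN.trans hM₁, hNi, Or.inr fun A hA hAi hUA => ?_⟩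
  obtain ⟨k, hk⟩ := hU A hAi hUA
  have hfin : (A ∩ Set.Iio k).Finite := (Set.finite_Iio k).inter_of_right A
  -- The initial segment of `A` that forces membership in `U` would be accepted above `k`.
  refine hrej hfin.toFinset (by simpa using Set.inter_subset_left.trans hA) (M₁ ∩ Set.Ici k)
    Set.inter_subset_left (hi₁.inter_Ici k) fun X hX hXi _ => ?_
  refine hk _ ?_ (hXi.mono Set.subset_union_right)
  rw [Set.Finite.coe_toFinset]
  ext x
  have : x ∈ X → k ≤ x := fun hx => (hX hx).2
  simp only [Set.mem_inter_iff, Set.mem_union, Set.mem_Iio]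
  constructor
  · rintro ⟨h | h, h'⟩
    · exact h
    · exact absurd (this h) (not_le.2 h')
  · exact fun h => ⟨Or.inl h, h.2⟩

/-- The Galvin–Nash-Williams theorem, for an open property of strictly increasing sequences. -/
theorem exists_homogeneous_strictMono {U : (ℕ → ℕ) → Prop}
    (hU : ∀ φ, U φ → ∃ L, ∀ ψ : ℕ → ℕ, (∀ k < L, ψ k = φ k) → U ψ)
    {M : Set ℕ} (hM : M.Infinite) :
    ∃ N ⊆ M, N.Infinite ∧
      ((∀ φ, StrictMono φ → Set.range φ ⊆ N → U φ) ∨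
        ∀ φ, StrictMono φ → Set.range φ ⊆ N → ¬ U φ) := by
  classical
  have hnth : ∀ φ : ℕ → ℕ, StrictMono φ → Nat.nth (· ∈ Set.range φ) = φ := fun φ hφ => by
    have hi := Set.infinite_range_of_injective hφ.injective
    refine ((Nat.nth_strictMono hi).range_inj hφ).1 ?_
    exact Nat.range_nth_of_infinite hi
  obtain ⟨N, hN, hNi, h⟩ := exists_homogeneous_of_open (U := fun A => U (Nat.nth (· ∈ A)))
    (fun A hA hUA => by
      obtain ⟨L, hL⟩ := hU _ hUA
      refine ⟨Nat.nth (· ∈ A) L, fun B hB _ => hL _ fun k hk => ?_⟩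
      have hlt : Nat.nth (· ∈ A) k < Nat.nth (· ∈ A) L := Nat.nth_strictMono hA hk
      have hiff : ∀ x < Nat.nth (· ∈ A) L, (x ∈ B ↔ x ∈ A) := fun x hx => by
        have := congrArg (x ∈ ·) hB
        simpa [hx] using this
      have hc : Nat.count (· ∈ B) (Nat.nth (· ∈ A) k) = k := by
        refine Eq.trans ?_ (Nat.count_nth_of_infinite (p := (· ∈ A)) hA k)
        rw [Nat.count_eq_card_filter_range, Nat.count_eq_card_filter_range]
        refine congrArg Finset.card (Finset.filter_congr fun x hx => hiff x ?_)
        exact (Finset.mem_range.1 hx).trans hlt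
      have hmem : Nat.nth (· ∈ A) k ∈ B := (hiff _ hlt).2 (Nat.nth_mem_of_infinite hA k)
      have := Nat.nth_count (p := (· ∈ B)) hmem
      rwa [hc] at this) hM
  refine ⟨N, hN, hNi, h.imp ?_ ?_⟩ <;> intro h φ hφ hr <;>
    have := h _ hr (Set.infinite_range_of_injective hφ.injective) <;>
    simpa only [hnth φ hφ] using this

/-! ### Decreasing nets of upper bounds -/

section Order

variable {X : Type*} [Lattice X]

/-- The index set of the net `(v, n) ↦ v - T n`, where `v` runs downwards through the upper bounds
of the sequence `T` below `u`. -/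
abbrev UpperBoundIndex (T : ℕ → X) (u : X) : Type _ :=
  {v : X // (∀ n, T n ≤ v) ∧ v ≤ u}ᵒᵈ × ULift ℕ

instance (T : ℕ → X) (u : X) : IsDirectedOrder (UpperBoundIndex T u) := by
  refine ⟨fun a b => ⟨(OrderDual.toDual ⟨(OrderDual.ofDual a.1).1 ⊓ (OrderDual.ofDual b.1).1,
    fun n => le_inf ((OrderDual.ofDual a.1).2.1 n) ((OrderDual.ofDual b.1).2.1 n),
    inf_le_left.trans (OrderDual.ofDual a.1).2.2⟩, ⟨max a.2.down b.2.down⟩), ?_, ?_⟩⟩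
  · exact ⟨(inf_le_left : _ ⊓ _ ≤ (OrderDual.ofDual a.1).1), le_max_left a.2.down b.2.down⟩
  · exact ⟨(inf_le_right : _ ⊓ _ ≤ (OrderDual.ofDual b.1).1), le_max_right a.2.down b.2.down⟩

theorem nonempty_upperBoundIndex {T : ℕ → X} {u : X} (hu : ∀ n, T n ≤ u) :
    Nonempty (UpperBoundIndex T u) :=
  ⟨(OrderDual.toDual ⟨u, hu, le_rfl⟩, ⟨0⟩)⟩

variable [NormedAddCommGroup X]

/-- The net `(v, n) ↦ v - T n`. -/
def upperBoundGap (T : ℕ → X) (u : X) (γ : UpperBoundIndex T u) : X :=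
  (OrderDual.ofDual γ.1).1 - T γ.2.down

variable [IsOrderedAddMonoid X]

theorem antitone_upperBoundGap {T : ℕ → X} (hT : Monotone T) (u : X) :
    Antitone (upperBoundGap T u) := fun a b h => by
  have h1 : (OrderDual.ofDual b.1).1 ≤ (OrderDual.ofDual a.1).1 := h.1
  exact sub_le_sub h1 (hT h.2)

theorem upperBoundGap_nonneg {T : ℕ → X} {u : X} (γ : UpperBoundIndex T u) :
    0 ≤ upperBoundGap T u γ :=
  sub_nonneg.2 ((OrderDual.ofDual γ.1).2.1 _)

variable [NormedSpace ℝ X] [IsOrderedModule ℝ X] [HasSolidNorm X]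

/-- The Archimedean property. -/
theorem nonpos_of_forall_nsmul_le {w y : X} (h : ∀ k : ℕ, k • w ≤ y) : w ≤ 0 := by
  have hlim : Tendsto (fun k : ℕ => (1 / ((k : ℝ) + 1)) • y) atTop (𝓝 0) := by
    simpa using (tendsto_one_div_add_atTop_nhds_zero_nat (𝕜 := ℝ)).smul_const y
  refine ge_of_tendsto' hlim fun k => ?_
  have hk : (0 : ℝ) < (k : ℝ) + 1 := by positivity
  have := smul_le_smul_of_nonneg_left (h (k + 1)) (by positivity : 0 ≤ 1 / ((k : ℝ) + 1))
  rw [← Nat.cast_smul_eq_nsmul ℝ, smul_smul] at this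
  push_cast at this
  rwa [one_div_mul_cancel hk.ne', one_smul] at this

/-- If `w` is a lower bound of the gaps, then subtracting `w` from an upper bound of `T` yields an
upper bound of `T` again; iterate and use the Archimedean property. -/
theorem isGLB_range_upperBoundGap {T : ℕ → X} {u : X} (hu : ∀ n, T n ≤ u) :
    IsGLB (Set.range (upperBoundGap T u)) 0 := by
  refine ⟨?_, fun w hw => ?_⟩
  · rintro _ ⟨γ, rfl⟩
    exact upperBoundGap_nonneg γ
  have hw' : ∀ v, (∀ n, T n ≤ v) → v ≤ u → ∀ n, w⁺ ≤ v - T n := fun v h1 h2 n =>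
    sup_le (hw ⟨(OrderDual.toDual ⟨v, h1, h2⟩, ⟨n⟩), rfl⟩) (sub_nonneg.2 (h1 n))
  have key : ∀ k : ℕ, (∀ n, T n ≤ u - k • w⁺) ∧ u - k • w⁺ ≤ u := by
    intro k
    induction k with
    | zero => simpa using hu
    | succ k ih =>
      refine ⟨fun n => ?_, sub_le_self _ (nsmul_nonneg (posPart_nonneg w) _)⟩
      have := hw' _ ih.1 ih.2 n
      rw [succ_nsmul, ← sub_sub]
      exact le_sub_comm.1 this
  exact (le_posPart w).trans (nonpos_of_forall_nsmul_le fun k => le_sub_comm.1 ((key k).1 0))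

/-- In an order continuous space, increasing order bounded sequences are norm Cauchy. -/
theorem IsOrderContinuous.cauchySeq (hX : IsOrderContinuous X) {T : ℕ → X} (hT : Monotone T)
    (hb : BddAbove (Set.range T)) : CauchySeq T := by
  obtain ⟨u, hu⟩ := hb
  have hu : ∀ n, T n ≤ u := fun n => hu ⟨n, rfl⟩
  have := nonempty_upperBoundIndex hu
  have hmem : u - T 0 ∈ orderContinuousPart X := by rw [hX]; trivial
  have hlim := hmem (UpperBoundIndex T u) (upperBoundGap T u)
    ⟨UpperBoundIndex T u, inferInstance, this, inferInstance, upperBoundGap T u,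
      antitone_upperBoundGap hT u, isGLB_range_upperBoundGap hu, fun γ => ⟨γ, fun α hα => by
        rw [sub_zero, abs_of_nonneg (upperBoundGap_nonneg α)]
        exact antitone_upperBoundGap hT u hα⟩⟩
    (fun α => by
      rw [abs_of_nonneg (upperBoundGap_nonneg α), abs_of_nonneg (sub_nonneg.2 (hu 0))]
      exact sub_le_sub (OrderDual.ofDual α.1).2.2 (hT (Nat.zero_le _)))
  rw [Metric.cauchySeq_iff']
  intro ε hε
  obtain ⟨γ, hγ⟩ := (hlim.eventually (gt_mem_nhds hε)).exists
  refine ⟨γ.2.down, fun n hn => ?_⟩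
  rw [dist_eq_norm]
  refine lt_of_le_of_lt (HasSolidNorm.solid ?_) hγ
  rw [abs_of_nonneg (sub_nonneg.2 (hT hn)), abs_of_nonneg (upperBoundGap_nonneg γ)]
  exact sub_le_sub_right ((OrderDual.ofDual γ.1).2.1 n) _

end Order

/-! ### Order convergence of Cesàro sequences -/

section Cesaro

variable {X : Type*} [NormedAddCommGroup X] [Lattice X] [IsOrderedAddMonoid X]

theorem abs_sum_le_sum_abs (f : ℕ → X) (N : ℕ) :
    |∑ n ∈ Finset.range N, f n| ≤ ∑ n ∈ Finset.range N, |f n| := by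
  induction N with
  | zero => simp
  | succ N ih =>
    rw [Finset.sum_range_succ, Finset.sum_range_succ]
    exact (abs_add_le _ _).trans (add_le_add ih le_rfl)

/-- The sum of disjoint positive elements is their supremum. -/
theorem sum_le_of_disjoint {a : ℕ → X} (h0 : ∀ n, 0 ≤ a n) (hd : ∀ i j, i ≠ j → a i ⊓ a j = 0)
    {v : X} (hv : ∀ n, a n ≤ v) (N : ℕ) : ∑ n ∈ Finset.range N, a n ≤ v := by
  have hdis : ∀ N k, N ≤ k → (∑ n ∈ Finset.range N, a n) ⊓ a k = 0 := by
    intro N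
    induction N with
    | zero => intro k _; simpa using h0 k
    | succ N ih =>
      intro k hk
      rw [Finset.sum_range_succ]
      have h1 := ih k (by omega)
      have h2 := hd N k (by omega)
      refine le_antisymm ?_ (le_inf (add_nonneg (Finset.sum_nonneg fun n _ => h0 n) (h0 N)) (h0 k))
      -- `(s + b) ⊓ c ≤ s ⊓ c + b ⊓ c` for nonnegative elements
      set s := ∑ n ∈ Finset.range N, a n
      have hs : 0 ≤ s := Finset.sum_nonneg fun n _ => h0 n
      have h3 : (s + a N) ⊓ a k - a N ≤ s ⊓ a k := by
        refine le_inf (sub_le_iff_le_add.2 inf_le_left) ?_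
        exact (sub_le_self _ (h0 N)).trans inf_le_right
      rw [h1, sub_nonpos] at h3
      exact h2 ▸ le_inf h3 inf_le_right
  induction N with
  | zero => simpa using (h0 0).trans (hv 0)
  | succ N ih =>
    rw [Finset.sum_range_succ, ← inf_add_sup, hdis N N le_rfl, zero_add]
    exact sup_le ih (hv N)

variable [NormedSpace ℝ X] [IsOrderedModule ℝ X]

/-- The weighted sum `∑_{k < L} g k / (k + p + 1)`. -/
def harmonicSum (p : ℕ) (g : ℕ → X) (L : ℕ) : X :=
  ∑ k ∈ Finset.range L, ((k : ℝ) + p + 1)⁻¹ • g k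

theorem monotone_harmonicSum (p : ℕ) {g : ℕ → X} (hg : ∀ n, 0 ≤ g n) :
    Monotone (harmonicSum p g) :=
  monotone_nat_of_le_succ fun n => by
    rw [harmonicSum, harmonicSum, Finset.sum_range_succ]
    exact le_add_of_nonneg_right (smul_nonneg (by positivity) (hg n))

theorem harmonicSum_nonneg (p : ℕ) {g : ℕ → X} (hg : ∀ n, 0 ≤ g n) (L : ℕ) :
    0 ≤ harmonicSum p g L :=
  Finset.sum_nonneg fun k _ => smul_nonneg (by positivity) (hg k)

/-- `|f n| / (n + 1)` is bounded by consecutive Cesàro means, and finitely many terms can be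
absorbed into the bound. -/
theorem OrderTendsto.exists_smul_abs_le {f : ℕ → X} {x : X} (h : OrderTendsto (cesaro f) x) :
    ∃ v : X, ∀ n : ℕ, ((n : ℝ) + 1)⁻¹ • |f n| ≤ v := by
  obtain ⟨Γ, _, ⟨γ⟩, _, h, -, -, hlim⟩ := h
  obtain ⟨m₀, hm₀⟩ := hlim γ
  have hc : ∀ m, m₀ ≤ m → |cesaro f m| ≤ |x| + h γ := fun m hm => by
    calc |cesaro f m| = |x + (cesaro f m - x)| := by rw [add_sub_cancel]
      _ ≤ |x| + |cesaro f m - x| := abs_add_le _ _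
      _ ≤ _ := add_le_add le_rfl (hm₀ m hm)
  have hnn : ∀ n : ℕ, 0 ≤ ((n : ℝ) + 1)⁻¹ • |f n| := fun n =>
    smul_nonneg (by positivity) (abs_nonneg _)
  have hv : 0 ≤ |x| + h γ := (abs_nonneg _).trans (hc m₀ le_rfl)
  refine ⟨(|x| + h γ + (|x| + h γ)) + ∑ n ∈ Finset.range (m₀ + 1), ((n : ℝ) + 1)⁻¹ • |f n|,
    fun n => ?_⟩
  rcases lt_or_ge n (m₀ + 1) with hn | hn
  · exact (Finset.single_le_sum (f := fun n : ℕ => ((n : ℝ) + 1)⁻¹ • |f n|) (fun i _ => hnn i)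
      (Finset.mem_range.2 hn)).trans (le_add_of_nonneg_left (add_nonneg hv hv))
  · obtain ⟨n, rfl⟩ : ∃ k, n = k + 1 := ⟨n - 1, by omega⟩
    refine le_trans ?_ (le_add_of_nonneg_right (Finset.sum_nonneg fun i _ => hnn i))
    have hn1 : (0 : ℝ) < (n : ℝ) + 1 := by positivity
    have hn2 : (0 : ℝ) < (n : ℝ) + 1 + 1 := by positivity
    have hid : (((n + 1 : ℕ) : ℝ) + 1)⁻¹ • f (n + 1) =
        cesaro f (n + 1) - (((n : ℝ) + 1 + 1)⁻¹ * ((n : ℝ) + 1)) • cesaro f n := by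
      rw [cesaro, cesaro, Finset.sum_range_succ _ (n + 1), smul_smul]
      push_cast
      rw [mul_assoc, mul_inv_cancel₀ hn1.ne', mul_one, smul_add, add_sub_cancel_left]
    have hr : |((n : ℝ) + 1 + 1)⁻¹ * ((n : ℝ) + 1)| ≤ 1 := by
      rw [abs_of_pos (by positivity), inv_mul_le_iff₀ hn2]
      linarith
    calc (((n + 1 : ℕ) : ℝ) + 1)⁻¹ • |f (n + 1)|
        = |(((n + 1 : ℕ) : ℝ) + 1)⁻¹ • f (n + 1)| := by
          rw [abs_real_smul, abs_of_pos (by positivity : (0:ℝ) < (((n + 1 : ℕ) : ℝ) + 1)⁻¹)]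
      _ ≤ |cesaro f (n + 1)| + |(((n : ℝ) + 1 + 1)⁻¹ * ((n : ℝ) + 1)) • cesaro f n| := by
          rw [hid, sub_eq_add_neg, ← abs_neg (_ • cesaro f n)]
          exact abs_add_le _ _
      _ ≤ |cesaro f (n + 1)| + |cesaro f n| := by
          refine add_le_add le_rfl ?_
          rw [abs_real_smul]
          exact smul_le_of_le_one_left (abs_nonneg _) hr
      _ ≤ _ := add_le_add (hc _ (by omega)) (hc _ (by omega))

theorem OrderTendsto.bddAbove_harmonicSum {f : ℕ → X} {x : X} (h : OrderTendsto (cesaro f) x)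
    (hd : ∀ i j, i ≠ j → |f i| ⊓ |f j| = 0) :
    BddAbove (Set.range (harmonicSum 0 fun n => |f n|)) := by
  obtain ⟨v, hv⟩ := h.exists_smul_abs_le
  refine ⟨v, ?_⟩
  rintro _ ⟨L, rfl⟩
  have h0 : ∀ n : ℕ, 0 ≤ ((n : ℝ) + 1)⁻¹ • |f n| := fun n =>
    smul_nonneg (by positivity) (abs_nonneg _)
  have hle : ∀ n : ℕ, ((n : ℝ) + 1)⁻¹ • |f n| ≤ |f n| := fun n =>
    smul_le_of_le_one_left
    (abs_nonneg _) (inv_le_one_of_one_le₀ (by linarith [n.cast_nonneg (α := ℝ)]))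
  have := sum_le_of_disjoint h0 (fun i j hij =>
    le_antisymm ((inf_le_inf (hle i) (hle j)).trans (hd i j hij).le) (le_inf (h0 i) (h0 j))) hv L
  simpa [harmonicSum] using this

variable [HasSolidNorm X]

/-- If `∑ |f n| / (n + 1)` has bounded partial sums, then the Cesàro sequence of `f` order converges
to `0`. It is dominated by `v - T m`, where
`T m = ∑_{n < m} (1 / (n + 1) - 1 / (m + 1)) |f n|` and `v` is any upper bound of `T`. -/
theorem orderTendsto_cesaro_zero {f : ℕ → X}
    (h : BddAbove (Set.range (harmonicSum 0 fun n => |f n|))) : OrderTendsto (cesaro f) 0 := by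
  obtain ⟨u, hu⟩ := h
  have hu : ∀ n, harmonicSum 0 (fun n => |f n|) n ≤ u := fun n => hu ⟨n, rfl⟩
  set T : ℕ → X := fun m => ∑ n ∈ Finset.range m, (((n : ℝ) + 1)⁻¹ - ((m : ℝ) + 1)⁻¹) • |f n|
    with hTdef
  have hT : Monotone T := monotone_nat_of_le_succ fun m => by
    simp only [hTdef, Finset.sum_range_succ]
    have hm : ((m + 1 : ℕ) + 1 : ℝ)⁻¹ ≤ ((m : ℝ) + 1)⁻¹ := by
      gcongr
      linarith
    refine (Finset.sum_le_sum fun n _ => ?_).trans (le_add_of_nonneg_right ?_)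
    · exact smul_le_smul_of_nonneg_right (by linarith) (abs_nonneg _)
    · exact smul_nonneg (by linarith) (abs_nonneg _)
  have hTS : ∀ m, T m = harmonicSum 0 (fun n => |f n|) m
      - ((m : ℝ) + 1)⁻¹ • ∑ n ∈ Finset.range m, |f n| := fun m => by
    simp [hTdef, harmonicSum, sub_smul, Finset.smul_sum]
  have hTu : ∀ n, T n ≤ u := fun n => by
    rw [hTS]
    exact (sub_le_self _ (smul_nonneg (by positivity)
      (Finset.sum_nonneg fun _ _ => abs_nonneg _))).trans (hu n)
  -- Every upper bound of `T` is an upper bound of the partial sums, by letting `m → ∞` in `T m`.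
  have hub : ∀ v, (∀ n, T n ≤ v) → ∀ N, harmonicSum 0 (fun n => |f n|) N ≤ v := by
    intro v hv N
    have hlim : Tendsto (fun m : ℕ => harmonicSum 0 (fun n => |f n|) N
        - ((m : ℝ) + 1)⁻¹ • ∑ n ∈ Finset.range N, |f n|) atTop
        (𝓝 (harmonicSum 0 (fun n => |f n|) N)) := by
      have := (tendsto_one_div_add_atTop_nhds_zero_nat (𝕜 := ℝ)).smul_const
        (∑ n ∈ Finset.range N, |f n|)
      simpa using this.const_sub (harmonicSum 0 (fun n => |f n|) N)
    refine le_of_tendsto hlim ((eventually_ge_atTop N).mono fun m hm => le_trans ?_ (hv m))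
    rw [Finset.smul_sum, harmonicSum, ← Finset.sum_sub_distrib]
    simp only [Nat.cast_zero, add_zero, ← sub_smul]
    refine Finset.sum_le_sum_of_subset_of_nonneg (Finset.range_mono hm) fun n hn _ => ?_
    refine smul_nonneg (sub_nonneg.2 ?_) (abs_nonneg _)
    gcongr
    exact (Finset.mem_range.1 hn).le
  refine ⟨UpperBoundIndex T u, inferInstance, nonempty_upperBoundIndex hTu, inferInstance,
    upperBoundGap T u, antitone_upperBoundGap hT u, isGLB_range_upperBoundGap hTu,
    fun γ => ⟨γ.2.down, fun m hm => ?_⟩⟩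
  rw [sub_zero, upperBoundGap]
  refine le_sub_iff_add_le.2 (le_trans ?_ (hub _ (OrderDual.ofDual γ.1).2.1 (m + 1)))
  have hc : |cesaro f m| ≤ ((m + 1 : ℕ) : ℝ)⁻¹ • ∑ n ∈ Finset.range (m + 1), |f n| := by
    rw [cesaro, abs_real_smul, abs_of_nonneg (by positivity)]
    exact smul_le_smul_of_nonneg_left (abs_sum_le_sum_abs f (m + 1))
      (by positivity)
  have hTm : T γ.2.down + ((m + 1 : ℕ) : ℝ)⁻¹ • ∑ n ∈ Finset.range (m + 1), |f n| ≤
      T m + ((m + 1 : ℕ) : ℝ)⁻¹ • ∑ n ∈ Finset.range (m + 1), |f n| :=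
    add_le_add (hT hm) le_rfl
  rw [add_comm]
  refine (add_le_add le_rfl hc).trans (hTm.trans (le_of_eq ?_))
  rw [hTS]
  simp only [harmonicSum, Finset.sum_range_succ, smul_add]
  push_cast
  simp only [add_zero]
  abel

end Cesaro

/-! ### Uniform bounds on weighted sums along all subsequences -/

section Uniform

variable {X : Type*} [NormedAddCommGroup X] [NormedSpace ℝ X]

theorem harmonicSum_zero_add_sub (a : ℕ → X) (i L : ℕ) :
    harmonicSum 0 a (i + L) - harmonicSum 0 a i = harmonicSum i (fun k => a (i + k)) L := by
  rw [harmonicSum, Finset.sum_range_add, harmonicSum, add_sub_cancel_left, harmonicSum]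
  refine Finset.sum_congr rfl fun k _ => ?_
  congr 2
  push_cast
  ring

variable [Lattice X] [IsOrderedAddMonoid X] [IsOrderedModule ℝ X] [HasSolidNorm X]

theorem norm_harmonicSum_anti {a : ℕ → X} (ha : ∀ n, 0 ≤ a n) {p q : ℕ} (h : p ≤ q) (L : ℕ) :
    ‖harmonicSum q a L‖ ≤ ‖harmonicSum p a L‖ := by
  refine HasSolidNorm.solid ?_
  rw [abs_of_nonneg (harmonicSum_nonneg q ha L), abs_of_nonneg (harmonicSum_nonneg p ha L)]
  refine Finset.sum_le_sum fun k _ => smul_le_smul_of_nonneg_right ?_ (ha k)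
  gcongr

theorem norm_harmonicSum_zero_le {a : ℕ → X} (ha : ∀ n, 0 ≤ a n) (p L : ℕ) :
    ‖harmonicSum 0 a L‖ ≤ ((p : ℝ) + 1) * ‖harmonicSum p a L‖ := by
  have hp : (0 : ℝ) ≤ (p : ℝ) + 1 := by positivity
  rw [← abs_of_nonneg hp, ← Real.norm_eq_abs, ← norm_smul]
  refine HasSolidNorm.solid ?_
  rw [abs_of_nonneg (harmonicSum_nonneg 0 ha L),
    abs_of_nonneg (smul_nonneg hp (harmonicSum_nonneg p ha L)), harmonicSum, harmonicSum,
    Finset.smul_sum]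
  refine Finset.sum_le_sum fun k _ => ?_
  rw [smul_smul]
  refine smul_le_smul_of_nonneg_right ?_ (ha k)
  rw [← div_eq_mul_inv, inv_eq_one_div, div_le_div_iff₀ (by positivity) (by positivity)]
  have : (0 : ℝ) ≤ (k : ℝ) * p := by positivity
  push_cast
  nlinarith

/-- If every infinite subset of `M` carries a sequence one of whose remainders is controlled by `c`,
then for some shift `p` the shifted sums are bounded by `c p` along *all* sequences in some infinite
subset of `M`. For each `p` the bound defines a closed, hence Ramsey, family of sequences; were all
these families avoided on some infinite set, fusing those sets would contradict the hypothesis. -/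
theorem exists_norm_harmonicSum_le {g : ℕ → X} (hg : ∀ n, 0 ≤ g n) {c : ℕ → ℝ} (hc : Monotone c)
    {M : Set ℕ} (hM : M.Infinite)
    (h : ∀ B ⊆ M, B.Infinite → ∃ φ : ℕ → ℕ, StrictMono φ ∧ Set.range φ ⊆ B ∧ ∃ i, ∀ L,
      ‖harmonicSum 0 (g ∘ φ) (i + 1 + L) - harmonicSum 0 (g ∘ φ) (i + 1)‖ ≤ c (i + 1)) :
    ∃ p, ∃ B ⊆ M, B.Infinite ∧ ∀ φ : ℕ → ℕ, StrictMono φ → Set.range φ ⊆ B → ∀ L,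
      ‖harmonicSum p (g ∘ φ) L‖ ≤ c p := by
  by_contra! hcon
  obtain ⟨N, hN, hNi, -, hD⟩ := exists_fusion
    (D := fun p A => ∀ φ : ℕ → ℕ, StrictMono φ → Set.range φ ⊆ A →
      ∃ L, c p < ‖harmonicSum p (g ∘ φ) L‖) hM
    (fun n A B hAB hB φ hφ hr => hB φ hφ (hr.trans hAB))
    (fun p A hA hAi => by
      obtain ⟨B, hB, hBi, h1 | h1⟩ := exists_homogeneous_strictMono
        (U := fun φ => ∃ L, c p < ‖harmonicSum p (g ∘ φ) L‖) (fun φ ⟨L, hL⟩ => by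
          refine ⟨L, fun ψ hψ => ⟨L, hL.trans_eq ?_⟩⟩
          congr 1
          refine Finset.sum_congr rfl fun k hk => ?_
          rw [Function.comp_apply, Function.comp_apply, hψ k (Finset.mem_range.1 hk)]) hAi
      · exact ⟨B, hB, hBi, h1⟩
      · obtain ⟨φ, hφ, hr, L, hL⟩ := hcon p B (hB.trans hA) hBi
        exact absurd ⟨L, hL⟩ (h1 φ hφ hr))
  obtain ⟨φ, hφ, hr, i, hi⟩ := h N hN hNi
  obtain ⟨L, hL⟩ := hD (φ i) (hr ⟨i, rfl⟩) (fun k => φ (i + 1 + k))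
    (fun a b hab => hφ (by omega)) (by
      rintro _ ⟨k, rfl⟩
      exact ⟨hr ⟨_, rfl⟩, hφ (by omega)⟩)
  have hle : i + 1 ≤ φ i + 1 := Nat.succ_le_succ hφ.le_apply
  have h1 := hi L
  rw [harmonicSum_zero_add_sub] at h1
  have h2 := norm_harmonicSum_anti (a := fun k => g (φ (i + 1 + k))) (fun n => hg _) hle L
  exact absurd (hL.trans_le (h2.trans h1)) (not_lt.2 (hc hle))

/-- In an order continuous space: if every infinite set of indices carries a sequence with order
bounded weighted sums, then so do all sequences in some fixed infinite set. -/
theorem IsOrderContinuous.exists_forall_bddAbove [CompleteSpace X] (hX : IsOrderContinuous X)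
    {g : ℕ → X} (hg : ∀ n, 0 ≤ g n)
    (h : ∀ B : Set ℕ, B.Infinite → ∃ φ : ℕ → ℕ, StrictMono φ ∧ Set.range φ ⊆ B ∧
      BddAbove (Set.range (harmonicSum 0 (g ∘ φ)))) :
    ∃ B : Set ℕ, B.Infinite ∧ ∀ φ : ℕ → ℕ, StrictMono φ → Set.range φ ⊆ B →
      BddAbove (Set.range (harmonicSum 0 (g ∘ φ))) := by
  obtain ⟨N, -, hNi, -, hD⟩ := exists_fusion
    (D := fun n A => ∃ p : ℕ, ∀ φ : ℕ → ℕ, StrictMono φ → Set.range φ ⊆ A → ∀ L,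
      ‖harmonicSum p (g ∘ φ) L‖ ≤ 1 / ((n : ℝ) + 1)) Set.infinite_univ
    (fun n A B hAB ⟨p, hp⟩ => ⟨p, fun φ hφ hr => hp φ hφ (hr.trans hAB)⟩)
    (fun n A _ hA => by
      obtain ⟨p, B, hB, hBi, hp⟩ := exists_norm_harmonicSum_le hg
        (c := fun _ => 1 / ((n : ℝ) + 1)) monotone_const hA (fun B _ hBi => by
          obtain ⟨φ, hφ, hr, hb⟩ := h B hBi
          have hC := hX.cauchySeq (monotone_harmonicSum 0 fun k => hg (φ k)) hb
          obtain ⟨i, hi⟩ := Metric.cauchySeq_iff.1 hC (1 / ((n : ℝ) + 1)) (by positivity)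
          refine ⟨φ, hφ, hr, i, fun L => ?_⟩
          rw [← dist_eq_norm]
          exact (hi _ (by omega) _ (by omega)).le)
      exact ⟨B, hB, hBi, p, hp⟩)
  refine ⟨N, hNi, fun φ hφ hr => ?_⟩
  have hmono := monotone_harmonicSum 0 fun k => hg (φ k)
  have hC : CauchySeq (harmonicSum 0 (g ∘ φ)) := by
    rw [Metric.cauchySeq_iff']
    intro ε hε
    obtain ⟨i, hi⟩ := exists_nat_one_div_lt hε
    obtain ⟨p, hp⟩ := hD (φ i) (hr ⟨i, rfl⟩)
    -- Beyond `j`, both the indices and the shift needed for the bound `1 / (φ i + 2)` are reached.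
    obtain ⟨j, hj⟩ : ∃ j, j = max (i + 1) p := ⟨_, rfl⟩
    refine ⟨j, fun n hn => ?_⟩
    obtain ⟨L, rfl⟩ := Nat.exists_eq_add_of_le hn
    rw [dist_eq_norm, harmonicSum_zero_add_sub]
    have h1 := norm_harmonicSum_anti (a := fun k => g (φ (j + k))) (fun n => hg _)
      (show p ≤ j by omega) L
    have h2 := hp (fun k => φ (j + k)) (fun a b hab => hφ (by omega)) (by
      rintro _ ⟨k, rfl⟩
      exact ⟨hr ⟨_, rfl⟩, hφ (by omega)⟩) L
    have h3 : 1 / (((φ i + 1 : ℕ) : ℝ) + 1) ≤ 1 / ((i : ℝ) + 1) := by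
      have : (i : ℝ) ≤ φ i := by exact_mod_cast hφ.le_apply
      refine one_div_le_one_div_of_le (by positivity) ?_
      push_cast
      linarith
    exact (h1.trans (h2.trans h3)).trans_lt hi
  obtain ⟨x, hx⟩ := cauchySeq_tendsto_of_complete hC
  refine ⟨x, ?_⟩
  rintro _ ⟨n, rfl⟩
  exact hmono.ge_of_tendsto hx n

/-- The analogue of `IsOrderContinuous.exists_forall_bddAbove` in a sequentially monotonically
bounded space. -/
theorem IsSeqMonotonicallyBounded.exists_forall_bddAbove (hX : IsSeqMonotonicallyBounded X)
    {g : ℕ → X} (hg : ∀ n, 0 ≤ g n)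
    (h : ∀ B : Set ℕ, B.Infinite → ∃ φ : ℕ → ℕ, StrictMono φ ∧ Set.range φ ⊆ B ∧
      BddAbove (Set.range (harmonicSum 0 (g ∘ φ)))) :
    ∃ B : Set ℕ, B.Infinite ∧ ∀ φ : ℕ → ℕ, StrictMono φ → Set.range φ ⊆ B →
      BddAbove (Set.range (harmonicSum 0 (g ∘ φ))) := by
  obtain ⟨p, B, -, hBi, hp⟩ := exists_norm_harmonicSum_le hg (c := fun n => (n : ℝ))
    Nat.mono_cast Set.infinite_univ (fun B _ hBi => by
      obtain ⟨φ, hφ, hr, u, hu⟩ := h B hBi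
      -- The bound `c (i + 1) = i + 1` is harmless once it exceeds the norm of the upper bound `u`.
      obtain ⟨i, hi⟩ := exists_nat_ge ‖u‖
      refine ⟨φ, hφ, hr, i, fun L => ?_⟩
      have hmono := monotone_harmonicSum 0 fun k => hg (φ k)
      have hu1 : harmonicSum 0 (g ∘ φ) (i + 1 + L) ≤ u := hu ⟨_, rfl⟩
      have h0 := harmonicSum_nonneg 0 (fun k => hg (φ k)) (i + 1)
      have hle : ‖harmonicSum 0 (g ∘ φ) (i + 1 + L) - harmonicSum 0 (g ∘ φ) (i + 1)‖ ≤ ‖u‖ := by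
        refine HasSolidNorm.solid ?_
        refine (abs_of_nonneg (sub_nonneg.2 (hmono (Nat.le_add_right (i + 1) L)))).trans_le ?_
        exact ((sub_le_self _ h0).trans hu1).trans (le_abs_self u)
      push_cast
      linarith)
  refine ⟨B, hBi, fun φ hφ hr => hX _ (monotone_harmonicSum 0 fun k => hg (φ k))
    (harmonicSum_nonneg 0 fun k => hg (φ k)) ⟨((p : ℝ) + 1) * p, fun L => ?_⟩⟩
  exact (norm_harmonicSum_zero_le (fun k => hg (φ k)) p L).trans
    (mul_le_mul_of_nonneg_left (hp φ hφ hr L) (by positivity))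

end Uniform

/-! ### From `doBSP` to its hereditary version -/

section BanachSaks

variable {X : Type*} [NormedAddCommGroup X] [Lattice X]

theorem IsBoundedDisjoint.comp {f : ℕ → X} (hf : IsBoundedDisjoint f) {φ : ℕ → ℕ}
    (hφ : StrictMono φ) : IsBoundedDisjoint (f ∘ φ) :=
  ⟨hf.1.imp fun _ hC _ => hC _, fun _ _ hij => hf.2 _ _ fun h => hij (hφ.injective h)⟩

variable [NormedSpace ℝ X]

theorem HasHereditaryOrderCesaroSubseq.hasOrderCesaroSubseq {f : ℕ → X}
    (h : HasHereditaryOrderCesaroSubseq f) : HasOrderCesaroSubseq f :=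
  let ⟨φ, hφ, x, hx⟩ := h
  ⟨φ, hφ, x, hx id strictMono_id⟩

/-- The core of the equivalence, for a single disjoint sequence: no boundedness or topology is
involved, only the fact that all subsequences have the non-hereditary property. -/
theorem hasHereditaryOrderCesaroSubseq_of_forall [CompleteSpace X] [IsOrderedAddMonoid X]
    [IsOrderedModule ℝ X] [HasSolidNorm X]
    (hX : IsOrderContinuous X ∨ IsSeqMonotonicallyBounded X) {f : ℕ → X}
    (hd : ∀ i j, i ≠ j → |f i| ⊓ |f j| = 0)
    (h : ∀ φ : ℕ → ℕ, StrictMono φ → HasOrderCesaroSubseq (f ∘ φ)) :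
    HasHereditaryOrderCesaroSubseq f := by
  have hg : ∀ n, 0 ≤ |f n| := fun n => abs_nonneg _
  have h' : ∀ B : Set ℕ, B.Infinite → ∃ φ : ℕ → ℕ, StrictMono φ ∧ Set.range φ ⊆ B ∧
      BddAbove (Set.range (harmonicSum 0 ((fun n => |f n|) ∘ φ))) := fun B hB => by
    have hmono : StrictMono (Nat.nth (· ∈ B)) := Nat.nth_strictMono hB
    obtain ⟨ψ, hψ, x, hx⟩ := h _ hmono
    refine ⟨Nat.nth (· ∈ B) ∘ ψ, hmono.comp hψ, ?_, ?_⟩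
    · rintro _ ⟨k, rfl⟩
      exact Nat.nth_mem_of_infinite hB _
    · exact hx.bddAbove_harmonicSum fun i j hij =>
        hd _ _ fun e => hij ((hmono.comp hψ).injective e)
  obtain ⟨B, hB, hall⟩ := hX.elim (fun hX => hX.exists_forall_bddAbove hg h')
    fun hX => hX.exists_forall_bddAbove hg h'
  have hmono : StrictMono (Nat.nth (· ∈ B)) := Nat.nth_strictMono hB
  refine ⟨Nat.nth (· ∈ B), hmono, 0, fun ψ hψ => orderTendsto_cesaro_zero ?_⟩
  refine hall (Nat.nth (· ∈ B) ∘ ψ) (hmono.comp hψ) ?_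
  rintro _ ⟨k, rfl⟩
  exact Nat.nth_mem_of_infinite hB _

theorem tauDoBSP_iff_tauHdoBSP [CompleteSpace X] [IsOrderedAddMonoid X]
    [IsOrderedModule ℝ X] [HasSolidNorm X]
    (hX : IsOrderContinuous X ∨ IsSeqMonotonicallyBounded X) (τ : TopologicalSpace X) :
    TauDoBSP τ ↔ TauHdoBSP τ :=
  ⟨fun h _ hτ hf => hasHereditaryOrderCesaroSubseq_of_forall hX hf.2 fun _ hφ =>
    h _ (hτ.comp hφ.tendsto_atTop) (hf.comp hφ),
  fun h f hτ hf => (h f hτ hf).hasOrderCesaroSubseq⟩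

theorem doBSP_iff_hdoBSP [CompleteSpace X] [IsOrderedAddMonoid X]
    [IsOrderedModule ℝ X] [HasSolidNorm X]
    (hX : IsOrderContinuous X ∨ IsSeqMonotonicallyBounded X) : DoBSP X ↔ HdoBSP X :=
  ⟨fun h _ hf => hasHereditaryOrderCesaroSubseq_of_forall hX hf.2 fun _ hφ => h _ (hf.comp hφ),
  fun h f hf => (h f hf).hasOrderCesaroSubseq⟩

end BanachSaks

end BanachLattice

end

theorem theorem3p6 {X : Type*} [NormedAddCommGroup X] [NormedSpace ℝ X] [CompleteSpace X]
    [Lattice X] [IsOrderedAddMonoid X] [IsOrderedModule ℝ X] [HasSolidNorm X]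
    (hX : BanachLattice.IsOrderContinuous X ∨ BanachLattice.IsSeqMonotonicallyBounded X) :
    (BanachLattice.DoBSP X ↔ BanachLattice.HdoBSP X) ∧
    ∀ I : Submodule ℝ (StrongDual ℝ X), BanachLattice.IsDualIdeal I →
      (BanachLattice.TauDoBSP (BanachLattice.sigmaTopology I) ↔
        BanachLattice.TauHdoBSP (BanachLattice.sigmaTopology I)) ∧
      (BanachLattice.TauDoBSP (BanachLattice.absSigmaTopology I) ↔
        BanachLattice.TauHdoBSP (BanachLattice.absSigmaTopology I)) := by
  exact ⟨BanachLattice.doBSP_iff_hdoBSP hX, fun _ _ =>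
    ⟨BanachLattice.tauDoBSP_iff_tauHdoBSP hX _, BanachLattice.tauDoBSP_iff_tauHdoBSP hX _⟩⟩
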